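/- Let $\mathcal Y\subset\mathbb R^h$ be compact, let $n\in\mathbb N$, and let $\Omega,W:\mathcal Y\times\mathcal Y\to\mathbb R$. Let $f_0,\dots,f_n$ be jointly measurable real random fields on $\mathcal Y$, and $\omega_0,\dots,\omega_{n-1}$ real random fields on $\mathcal Y$, all on one probability space, forming a linear Gaussian dynamical system: for each $0\le t<n$ and each $\zeta\in\mathcal Y$, almost surely $$f_{t+1}(\zeta)=(\Omega f_t)(\zeta)+\omega_t(\zeta),\qquad (\Omega u)(\zeta)=\int_{\mathcal Y}\Omega(\zeta,\zeta')u(\zeta')\,d\zeta',$$ where $f_0$ is a centred Gaussian process, $\omega_t\sim\mathcal{GP}(0,W)$, and $\omega_t$ is independent of $f_t$. Put $\Psi_t(\zeta_1,\zeta_2)=\mathbb E[f_t(\zeta_1)f_t(\zeta_2)]$. Assume: 1. $\Omega$ and $W$ are Lipschitz in each argument, with constants $L_\Omega$ and $L_W$ that do not depend on the other argument; $\Psi_0$ is Lipschitz in each argument, uniformly in the other. 2. For some $C\in(0,1)$, $\|\Omega u-\Omega v\|_{L^2(\mathcal Y)}\le C\|u-v\|_{L^2(\mathcal Y)}$ for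 all $u,v\in L^2(\mathcal Y)$. 3. $W$ is positive semidefinite: $\sum_{i,j=1}^d c_ic_jW(\zeta_i,\zeta_j)\ge0$ for all $d\in\mathbb N$, $\zeta_1,\dots,\zeta_d\in\mathcal Y$, $c\in\mathbb R^d$. 4. For $1\le t\le n$, $\Psi_t$ is positive definite: $\sum_{i,j=1}^d c_ic_j\Psi_t(\zeta_i,\zeta_j)>0$ for all $d\in\mathbb N$, pairwise distinct $\zeta_1,\dots,\zeta_d\in\mathcal Y$ and $c\in\mathbb R^d\setminus\{0\}$. Then: (a) for $0\le t\le n$ and $\zeta\in\mathcal Y$, $f_t(\zeta)$ is square integrable with mean $0$ (so $\Psi_t$ is the covariance kernel of $f_t$), and for $0\le t<n$ $$\Psi_{t+1}=\Omega\Psi_t\Omega'+W,\qquad (\Omega\Psi_t\Omega')(\zeta_1,\zeta_2)=\int_{\mathcal Y}\int_{\mathcal Y}\Omega(\zeta_1,\eta_1)\Psi_t(\eta_1,\eta_2)\Omega(\zeta_2,\eta_2)\,d\eta_2\,d\eta_1;$$ (b) for $0\le t\le n$, $\Psi_t$ is Lipschitz in each argument, uniformly in the other; (c) for $0\le t\le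 n$, $f_t$ is almost surely continuous on $\mathcal Y$: it has a modification all of whose sample paths are continuous, and if $f_t$ is separable then its own sample paths are almost surely continuous. (Here $f_t$ is separable if there is a countable $D\subset\mathcal Y$ such that, almost surely, for every $\zeta\in\mathcal Y$ the point $(\zeta,f_t(\zeta))$ lies in the closure of $\{(\eta,f_t(\eta)):\eta\in D\}$.) -/

import Mathlib

open MeasureTheory ProbabilityTheory
open scoped NNReal ENNReal

noncomputable section

namespace LGDS

/-- `K` is Lipschitz in each of its two arguments, with constant `L` uniform in the other one. -/
def IsLipschitzKernel {Y : Type*} [PseudoMetricSpace Y] (L : ℝ≥0) (K : Y → Y → ℝ) : Prop :=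
  (∀ y, LipschitzWith L (fun x => K x y)) ∧ (∀ x, LipschitzWith L (fun y => K x y))

/-- Positive semidefinite kernel. -/
def IsPosSemidefKernel {Y : Type*} (K : Y → Y → ℝ) : Prop :=
  ∀ (d : ℕ) (x : Fin d → Y) (c : Fin d → ℝ), 0 ≤ ∑ i, ∑ j, c i * c j * K (x i) (x j)

/-- (Strictly) positive definite kernel: distinct points, coefficients not all zero. -/
def IsPosDefKernel {Y : Type*} (K : Y → Y → ℝ) : Prop :=
  ∀ (d : ℕ) (x : Fin d → Y) (c : Fin d → ℝ), Function.Injective x → c ≠ 0 →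
    0 < ∑ i, ∑ j, c i * c j * K (x i) (x j)

/-- Lebesgue measure on a subset `Y` of `ℝ^h`, as a measure on the subtype. -/
def lebesgueOn {h : ℕ} (Y : Set (EuclideanSpace ℝ (Fin h))) : Measure Y :=
  Measure.comap (Subtype.val : Y → EuclideanSpace ℝ (Fin h)) volume

/-- The integral operator `(Ω u)(ζ) = ∫ Ω(ζ, ζ') u(ζ') μ(dζ')`. -/
def kernelOp {Y : Type*} [MeasurableSpace Y] (μ : Measure Y) (Ω : Y → Y → ℝ) (u : Y → ℝ) (ζ : Y) : ℝ :=
  ∫ ζ', Ω ζ ζ' * u ζ' ∂μ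

/-- The kernel `(Ω K Ω')(ζ₁, ζ₂) = ∬ Ω(ζ₁, η₁) K(η₁, η₂) Ω(ζ₂, η₂) μ(dη₁) μ(dη₂)`. -/
def kernelConj {Y : Type*} [MeasurableSpace Y] (μ : Measure Y) (Ω K : Y → Y → ℝ)
    (ζ₁ ζ₂ : Y) : ℝ :=
  ∫ η₁, ∫ η₂, Ω ζ₁ η₁ * K η₁ η₂ * Ω ζ₂ η₂ ∂μ ∂μ

/-- The integral operator with kernel `Ω` is a contraction of `L²(μ)` with constant `C`. -/
def IsContractingKernel {Y : Type*} [MeasurableSpace Y] (μ : Measure Y) (C : ℝ)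
    (Ω : Y → Y → ℝ) : Prop :=
  ∀ u v : Y → ℝ, MemLp u 2 μ → MemLp v 2 μ →
    eLpNorm (fun ζ => kernelOp μ Ω u ζ - kernelOp μ Ω v ζ) 2 μ
      ≤ ENNReal.ofReal C * eLpNorm (fun ζ => u ζ - v ζ) 2 μ

/-- The covariance function `(ζ₁, ζ₂) ↦ E[X(ζ₁) X(ζ₂)]` of a centred random field. -/
def covKernel {Y S : Type*} [MeasurableSpace S] (P : Measure S) (X : Y → S → ℝ)
    (ζ₁ ζ₂ : Y) : ℝ :=
  ∫ s, X ζ₁ s * X ζ₂ s ∂P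

/-- `X ∼ GP(0, K)`. -/
structure IsCenteredGP {Y S : Type*} [MeasurableSpace S] (P : Measure S) (X : Y → S → ℝ)
    (K : Y → Y → ℝ) : Prop where
  gaussian : IsGaussianProcess X P
  mean_zero : ∀ ζ, ∫ s, X ζ s ∂P = 0
  cov_eq : ∀ ζ₁ ζ₂, covKernel P X ζ₁ ζ₂ = K ζ₁ ζ₂

/-- `f` is the state, up to time `n`, of the linear Gaussian dynamical system
`f_{t+1} = Ω f_t + ω_t` with noise `ω_t ∼ GP(0, W)` independent of the current state `f_t`
and centred Gaussian initial state. -/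
structure IsLGDS {Y S : Type*} [MeasurableSpace Y] [MeasurableSpace S] (μ : Measure Y)
    (P : Measure S) (n : ℕ) (Ω W : Y → Y → ℝ) (f ω : ℕ → Y → S → ℝ) : Prop where
  measurable : ∀ t ≤ n, Measurable (fun p : Y × S => f t p.1 p.2)
  initial : IsCenteredGP P (f 0) (covKernel P (f 0))
  noise : ∀ t < n, IsCenteredGP P (ω t) W
  indep : ∀ t < n, IndepFun (fun s ζ => f t ζ s) (fun s ζ => ω t ζ s) P
  dynamics : ∀ t < n, ∀ ζ, ∀ᵐ s ∂P,
    f (t + 1) ζ s = kernelOp μ Ω (fun ζ' => f t ζ' s) ζ + ω t ζ s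

/-- Some version (modification) of the random field `X` has only continuous sample paths. -/
def HasContinuousVersion {Y S : Type*} [TopologicalSpace Y] [MeasurableSpace S] (P : Measure S)
    (X : Y → S → ℝ) : Prop :=
  ∃ g : Y → S → ℝ, (∀ ζ, Measurable (g ζ)) ∧ (∀ s, Continuous (fun ζ => g ζ s)) ∧
    ∀ ζ, ∀ᵐ s ∂P, g ζ s = X ζ s

/-- Separability of a random field (in the sense of Doob): almost surely, the whole sample path
is determined through limits by its values on a fixed countable set. -/
def IsSeparableField {Y S : Type*} [TopologicalSpace Y] [MeasurableSpace S] (P : Measure S)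
    (X : Y → S → ℝ) : Prop :=
  ∃ D : Set Y, D.Countable ∧ ∀ᵐ s ∂P, ∀ ζ : Y,
    (ζ, X ζ s) ∈ closure ((fun η => (η, X η s)) '' D)

end LGDS

end

/-! The closed linear span in `L²(P)` of a Gaussian process consists of Gaussian variables, since
pointwise limits of Gaussian characteristic functions are Gaussian. The weighted integral
`∫ Ω(ζ, η) f_t(η) dη` is orthogonal to everything orthogonal to the values of `f_t`, so it lies in
that span, and `f_{t+1}` is again a centred Gaussian process; Fubini gives its covariance
`Ω Ψ_t Ω' + W`, which is Lipschitz because `Ω` and `W` are. A Lipschitz covariance bounds the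
variance of increments by a multiple of the distance, hence all their even moments, and chaining
over nets of exponentially growing cardinality yields a continuous version. Finally, the closed
graph of that version contains the whole path of a separable field once it contains its values on
the separating set. -/

namespace LGDS

open Filter Topology

section GaussianSpace

variable {S : Type*} [MeasurableSpace S] {P : Measure S}

lemma toLp_inner_toLp {U V : S → ℝ} (hU : MemLp U 2 P) (hV : MemLp V 2 P) :
    inner ℝ (hU.toLp U) (hV.toLp V) = ∫ s, U s * V s ∂P := by
  rw [L2.inner_def]
  refine integral_congr_ae ?_
  filter_upwards [hU.coeFn_toLp, hV.coeFn_toLp] with s hUs hVs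
  rw [hUs, hVs, real_inner_eq_re_inner, RCLike.inner_apply]
  simp [mul_comm]

lemma continuous_integral_L2 [IsFiniteMeasure P] :
    Continuous fun Z : Lp ℝ 2 P => ∫ s, Z s ∂P := by
  have hinner : ∀ Z : Lp ℝ 2 P,
      ∫ s, Z s ∂P = inner ℝ (indicatorConstLp 2 MeasurableSet.univ (measure_ne_top P _) 1) Z := by
    intro Z
    rw [L2.inner_indicatorConstLp_one, Measure.restrict_univ]
  simp only [hinner]
  fun_prop

lemma continuous_variance_L2 [IsProbabilityMeasure P] :
    Continuous fun Z : Lp ℝ 2 P => Var[Z; P] := by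
  have hvar : ∀ Z : Lp ℝ 2 P, Var[Z; P] = ‖Z‖ ^ 2 - (∫ s, Z s ∂P) ^ 2 := by
    intro Z
    rw [variance_eq_sub (Lp.memLp Z), ← real_inner_self_eq_norm_sq, L2.inner_def]
    simp [sq]
  simp only [hvar]
  exact (continuous_norm.pow 2).sub (continuous_integral_L2.pow 2)

lemma continuous_charFun_map_L2 [IsProbabilityMeasure P] (t : ℝ) :
    Continuous fun Z : Lp ℝ 2 P => charFun (P.map Z) t := by
  refine continuous_iff_seqContinuous.2 fun Z Z' hZ => ?_
  have hdist : TendstoInDistribution (fun k => Z k) atTop Z' (fun _ => P) P :=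
    (tendstoInMeasure_of_tendsto_eLpNorm (by norm_num) (fun k => Lp.aestronglyMeasurable (Z k))
      (Lp.aestronglyMeasurable Z') ((Lp.tendsto_Lp_iff_tendsto_eLpNorm' _ _).1 hZ)
      ).tendstoInDistribution fun k => (Lp.aestronglyMeasurable (Z k)).aemeasurable
  exact ProbabilityMeasure.tendsto_iff_tendsto_charFun.1 hdist.tendsto t

lemma isClosed_setOf_hasGaussianLaw [IsProbabilityMeasure P] :
    IsClosed {Z : Lp ℝ 2 P | HasGaussianLaw Z P} := by
  have hchar : ∀ Z : Lp ℝ 2 P, HasGaussianLaw Z P ↔ ∀ t : ℝ, charFun (P.map Z) t =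
      Complex.exp ((t * ∫ s, Z s ∂P : ℝ) * Complex.I - (t ^ 2 * Var[Z; P] : ℝ) / 2) := by
    intro Z
    rw [hasGaussianLaw_iff_charFun_map_eq (Lp.aestronglyMeasurable Z).aemeasurable]
    simp only [RCLike.inner_apply, conj_trivial, mul_comm _ (_ : ℝ), integral_const_mul,
      variance_const_mul]
  simp only [hchar, Set.ofPred_forall]
  refine isClosed_iInter fun t => isClosed_eq (continuous_charFun_map_L2 t) ?_
  have hmean := continuous_integral_L2 (P := P)
  have hvar := continuous_variance_L2 (P := P)
  fun_prop

lemma hasGaussianLaw_of_dual {E : Type*} [NormedAddCommGroup E] [NormedSpace ℝ E]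
    [MeasurableSpace E] [BorelSpace E] {Z : S → E} (hZ : AEMeasurable Z P)
    (h : ∀ L : StrongDual ℝ E, HasGaussianLaw (fun s => L (Z s)) P) : HasGaussianLaw Z P where
  isGaussian_map := ⟨fun L => by
    have hL : Measurable L := L.continuous.measurable
    rw [AEMeasurable.map_map_of_aemeasurable hL.aemeasurable hZ,
      integral_map hZ (by fun_prop), variance_map (by fun_prop) hZ]
    exact (h L).map_eq_gaussianReal⟩

/-- The closed linear span in `L²(P)` of a square-integrable family `X`. When `X` is a Gaussian
process, this is its Gaussian Hilbert space. -/
noncomputable def closedSpan {T : Type*} {X : T → S → ℝ} (hX : ∀ t, MemLp (X t) 2 P) :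
    Submodule ℝ (Lp ℝ 2 P) :=
  (Submodule.span ℝ (Set.range fun t => (hX t).toLp (X t))).topologicalClosure

variable {T : Type*} {X : T → S → ℝ}

lemma toLp_mem_closedSpan (hX : ∀ t, MemLp (X t) 2 P) (t : T) :
    (hX t).toLp (X t) ∈ closedSpan hX :=
  Submodule.le_topologicalClosure _ (Submodule.subset_span ⟨t, rfl⟩)

lemma toLp_mem_closedSpan_of_orthogonal (hX : ∀ t, MemLp (X t) 2 P) {J : S → ℝ}
    (hJ : MemLp J 2 P)
    (h : ∀ V, MemLp V 2 P → (∀ t, ∫ s, X t s * V s ∂P = 0) → ∫ s, J s * V s ∂P = 0) :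
    hJ.toLp J ∈ closedSpan hX := by
  rw [closedSpan, ← Submodule.orthogonal_orthogonal_eq_closure, Submodule.mem_orthogonal']
  intro V hV
  rw [← Lp.toLp_coeFn V (Lp.memLp V), toLp_inner_toLp]
  refine h V (Lp.memLp V) fun t => ?_
  rw [← toLp_inner_toLp (hX t) (Lp.memLp V), Lp.toLp_coeFn]
  exact (Submodule.mem_orthogonal _ _).1 hV _ (Submodule.subset_span ⟨t, rfl⟩)

lemma hasGaussianLaw_of_mem_closedSpan (hX : IsGaussianProcess X P)
    {hX₂ : ∀ t, MemLp (X t) 2 P} {Z : Lp ℝ 2 P} (hZ : Z ∈ closedSpan hX₂) :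
    HasGaussianLaw Z P := by
  have := hX.isProbabilityMeasure
  refine closure_minimal (fun U hU => ?_) isClosed_setOf_hasGaussianLaw hZ
  obtain ⟨c, rfl⟩ := Finsupp.mem_span_range_iff_exists_finsupp.1 hU
  have hsum : HasGaussianLaw (fun s => ∑ t ∈ c.support, c t • X t s) P :=
    (hX.smul c).hasGaussianLaw_fun_sum
  refine hsum.congr ?_
  have hX_ae : ∀ᵐ s ∂P, ∀ t ∈ c.support, (c t • (hX₂ t).toLp (X t)) s = c t • X t s :=
    (ae_ball_iff c.support.countable_toSet).2 fun t _ => by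
      filter_upwards [Lp.coeFn_smul (c t) ((hX₂ t).toLp (X t)), (hX₂ t).coeFn_toLp] with s h1 h2
      rw [h1, Pi.smul_apply, h2]
  filter_upwards [Lp.coeFn_fun_finsetSum c.support fun t => c t • (hX₂ t).toLp (X t), hX_ae]
    with s hs hXs
  rw [Finsupp.sum, hs]
  exact (Finset.sum_congr rfl hXs).symm

lemma isGaussianProcess_of_mem_closedSpan (hX : IsGaussianProcess X P)
    {hX₂ : ∀ t, MemLp (X t) 2 P} {U : Type*} {Z : U → S → ℝ} (hZ₂ : ∀ u, MemLp (Z u) 2 P)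
    (hZ : ∀ u, (hZ₂ u).toLp (Z u) ∈ closedSpan hX₂) : IsGaussianProcess Z P := by
  classical
  refine ⟨fun I => hasGaussianLaw_of_dual
    (aemeasurable_pi_lambda _ fun i => (hZ₂ i).1.aemeasurable) fun Λ => ?_⟩
  let c : I → ℝ := fun i => Λ (Pi.single i 1)
  have hmem : ∑ i : I, c i • (hZ₂ i).toLp (Z i) ∈ closedSpan hX₂ :=
    Submodule.sum_mem _ fun i _ => Submodule.smul_mem _ _ (hZ i)
  refine (hasGaussianLaw_of_mem_closedSpan hX hmem).congr ?_
  have hZ_ae : ∀ᵐ s ∂P, ∀ i : I, (c i • (hZ₂ i).toLp (Z i)) s = c i • Z i s :=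
    ae_all_iff.2 fun i => by
      filter_upwards [Lp.coeFn_smul (c i) ((hZ₂ i).toLp (Z i)), (hZ₂ i).coeFn_toLp] with s h1 h2
      rw [h1, Pi.smul_apply, h2]
  filter_upwards [Lp.coeFn_fun_finsetSum Finset.univ fun i : I => c i • (hZ₂ i).toLp (Z i), hZ_ae]
    with s hs hZs
  rw [hs, pi_eq_sum_univ' (I.restrict fun i => Z i s)]
  simp [map_sum, hZs, c, mul_comm]

lemma isGaussianProcess_sumElim {U : Type*} {w : U → S → ℝ} (hX : IsGaussianProcess X P)
    (hw : IsGaussianProcess w P) (hind : IndepFun (fun s t => X t s) (fun s u => w u s) P) :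
    IsGaussianProcess (Sum.elim X w) P := by
  refine ⟨fun I => ?_⟩
  have hjoint :
      HasGaussianLaw (fun s => (I.toLeft.restrict (X · s), I.toRight.restrict (w · s))) P :=
    (hind.comp (Finset.measurable_restrict I.toLeft)
      (Finset.measurable_restrict I.toRight)).hasGaussianLaw (hX.hasGaussianLaw _)
      (hw.hasGaussianLaw _)
  let Λ : (I.toLeft → ℝ) × (I.toRight → ℝ) →L[ℝ] (I → ℝ) := ContinuousLinearMap.pi fun
    | ⟨.inl t, ht⟩ => .proj ⟨t, Finset.mem_toLeft.2 ht⟩ ∘L .fst ℝ _ _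
    | ⟨.inr u, hu⟩ => .proj ⟨u, Finset.mem_toRight.2 hu⟩ ∘L .snd ℝ _ _
  refine (hjoint.map_fun Λ).congr (ae_of_all _ fun s => funext fun i => ?_)
  rcases i with ⟨t | u, h⟩ <;> rfl

end GaussianSpace

section RandomIntegral

variable {Y S : Type*} [MeasurableSpace Y] [MeasurableSpace S] {μ : Measure Y} {P : Measure S}

lemma sq_integral_mul_le {U V : S → ℝ} (hU : MemLp U 2 P) (hV : MemLp V 2 P) :
    (∫ s, U s * V s ∂P) ^ 2 ≤ (∫ s, U s ^ 2 ∂P) * ∫ s, V s ^ 2 ∂P := by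
  simpa only [toLp_inner_toLp, sq] using
    real_inner_mul_inner_self_le (hU.toLp U) (hV.toLp V)

lemma memLp_two_prod [SFinite P] {X : Y → S → ℝ} (hXm : Measurable fun p : Y × S => X p.1 p.2)
    (hX : ∀ η, MemLp (X η) 2 P) (hint : Integrable (fun η => ∫ s, X η s ^ 2 ∂P) μ) :
    MemLp (fun p : Y × S => X p.1 p.2) 2 (μ.prod P) := by
  refine (memLp_two_iff_integrable_sq hXm.aestronglyMeasurable).2 ?_
  refine (integrable_prod_iff (hXm.pow_const 2).aestronglyMeasurable).2
    ⟨ae_of_all _ fun η => (hX η).integrable_sq, ?_⟩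
  simpa only [norm_pow, Real.norm_eq_abs, sq_abs] using hint

variable {X : Y → S → ℝ} {a : Y → ℝ} {V : S → ℝ}

lemma memLp_two_weight_mul (ha : MemLp a 2 μ) (hV : MemLp V 2 P) :
    MemLp (fun p : Y × S => a p.1 * V p.2) 2 (μ.prod P) := by
  refine (memLp_two_iff_integrable_sq (ha.1.comp_fst.mul hV.1.comp_snd)).2 ?_
  simpa only [Pi.mul_apply, mul_pow] using ha.integrable_sq.mul_prod hV.integrable_sq

lemma integrable_weight_mul_field_mul (hX : MemLp (fun p : Y × S => X p.1 p.2) 2 (μ.prod P))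
    (ha : MemLp a 2 μ) (hV : MemLp V 2 P) :
    Integrable (fun p : Y × S => a p.1 * (X p.1 p.2 * V p.2)) (μ.prod P) := by
  refine (MemLp.integrable_mul (memLp_two_weight_mul ha hV) hX).congr (ae_of_all _ fun p => ?_)
  simp only [Pi.mul_apply]
  ring

variable [SFinite μ] [SFinite P]

lemma integral_weighted_integral_mul (hX : MemLp (fun p : Y × S => X p.1 p.2) 2 (μ.prod P))
    (ha : MemLp a 2 μ) (hV : MemLp V 2 P) :
    ∫ s, (∫ η, a η * X η s ∂μ) * V s ∂P = ∫ η, a η * ∫ s, X η s * V s ∂P ∂μ := by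
  simp only [← integral_mul_const, ← integral_const_mul, mul_assoc]
  exact (integral_integral_swap (integrable_weight_mul_field_mul hX ha hV)).symm

lemma memLp_weighted_integral (hX : MemLp (fun p : Y × S => X p.1 p.2) 2 (μ.prod P))
    (ha : MemLp a 2 μ) : MemLp (fun s => ∫ η, a η * X η s ∂μ) 2 P := by
  have hJ : AEStronglyMeasurable (fun s => ∫ η, a η * X η s ∂μ) P :=
    (ha.1.comp_fst.mul hX.1).prod_swap.integral_prod_right'
  refine (memLp_two_iff_integrable_sq hJ).2 ?_
  refine (hX.integrable_sq.integral_prod_right.const_mul (∫ η, a η ^ 2 ∂μ)).mono'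
    (hJ.pow 2) ?_
  filter_upwards [hX.integrable_sq.prod_left_ae, hX.1.prod_swap.prodMk_left] with s hs hsm
  rw [Real.norm_of_nonneg (sq_nonneg _)]
  exact sq_integral_mul_le ha ((memLp_two_iff_integrable_sq hsm).2 hs)

lemma weighted_integral_mem_closedSpan {T : Type*} {Z : T → S → ℝ} (hZ : ∀ t, MemLp (Z t) 2 P)
    {i : Y → T} (hX : MemLp (fun p : Y × S => Z (i p.1) p.2) 2 (μ.prod P)) (ha : MemLp a 2 μ) :
    (memLp_weighted_integral (X := fun η => Z (i η)) hX ha).toLp _ ∈ closedSpan hZ := by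
  refine toLp_mem_closedSpan_of_orthogonal hZ _ fun V hV hort => ?_
  rw [integral_weighted_integral_mul hX ha hV]
  simp [hort]

end RandomIntegral

section Transition

variable {Y S : Type*} [MeasurableSpace S] {P : Measure S} {X X' w : Y → S → ℝ}
  {Ω K W : Y → Y → ℝ}

lemma IsCenteredGP.memLp (hX : IsCenteredGP P X K) (ζ : Y) : MemLp (X ζ) 2 P :=
  (hX.gaussian.hasGaussianLaw_eval ζ).memLp_two

lemma IsCenteredGP.congr (hX : IsCenteredGP P X K) (h : ∀ ζ, X ζ =ᵐ[P] X' ζ) :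
    IsCenteredGP P X' K where
  gaussian := hX.gaussian.congr h
  mean_zero ζ := (integral_congr_ae (h ζ)).symm.trans (hX.mean_zero ζ)
  cov_eq ζ₁ ζ₂ := (integral_congr_ae ((h ζ₁).mul (h ζ₂))).symm.trans (hX.cov_eq ζ₁ ζ₂)

lemma IsCenteredGP.integral_mul_eq_zero_of_indepFun (hX : IsCenteredGP P X K)
    (hw : IsCenteredGP P w W) (hind : IndepFun (fun s ζ => X ζ s) (fun s ζ => w ζ s) P)
    (ζ₁ ζ₂ : Y) : ∫ s, X ζ₁ s * w ζ₂ s ∂P = 0 := by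
  have hi : IndepFun (X ζ₁) (w ζ₂) P := hind.comp (measurable_pi_apply ζ₁) (measurable_pi_apply ζ₂)
  rw [hi.integral_fun_mul_eq_mul_integral (hX.memLp ζ₁).1 (hw.memLp ζ₂).1, hX.mean_zero, zero_mul]

lemma covKernel_add_of_orthogonal {J : Y → S → ℝ} (hJ : ∀ ζ, MemLp (J ζ) 2 P)
    (hw : ∀ ζ, MemLp (w ζ) 2 P) (hJw : ∀ ζ₁ ζ₂, ∫ s, J ζ₁ s * w ζ₂ s ∂P = 0) (ζ₁ ζ₂ : Y) :
    covKernel P (fun ζ s => J ζ s + w ζ s) ζ₁ ζ₂ = covKernel P J ζ₁ ζ₂ + covKernel P w ζ₁ ζ₂ := by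
  have hJJ : Integrable (fun s => J ζ₁ s * J ζ₂ s) P := MemLp.integrable_mul (hJ ζ₁) (hJ ζ₂)
  have hJ₁w : Integrable (fun s => J ζ₁ s * w ζ₂ s) P := MemLp.integrable_mul (hJ ζ₁) (hw ζ₂)
  have hJ₂w : Integrable (fun s => J ζ₂ s * w ζ₁ s) P := MemLp.integrable_mul (hJ ζ₂) (hw ζ₁)
  have hww : Integrable (fun s => w ζ₁ s * w ζ₂ s) P := MemLp.integrable_mul (hw ζ₁) (hw ζ₂)
  calc covKernel P (fun ζ s => J ζ s + w ζ s) ζ₁ ζ₂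
      = ∫ s, (J ζ₁ s * J ζ₂ s + J ζ₁ s * w ζ₂ s) + (J ζ₂ s * w ζ₁ s + w ζ₁ s * w ζ₂ s) ∂P :=
        integral_congr_ae (ae_of_all _ fun s => by ring)
    _ = (covKernel P J ζ₁ ζ₂ + ∫ s, J ζ₁ s * w ζ₂ s ∂P)
        + (∫ s, J ζ₂ s * w ζ₁ s ∂P + covKernel P w ζ₁ ζ₂) := by
        rw [covKernel, covKernel, ← integral_add hJJ hJ₁w, ← integral_add hJ₂w hww,
          ← integral_add (by exact hJJ.add hJ₁w) (by exact hJ₂w.add hww)]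
    _ = _ := by rw [hJw, hJw, add_zero, zero_add]

variable [MeasurableSpace Y] {μ : Measure Y}

lemma IsCenteredGP.memLp_prod [IsProbabilityMeasure P] (hX : IsCenteredGP P X K)
    (hXm : Measurable fun p : Y × S => X p.1 p.2) (hK : Integrable (fun η => K η η) μ) :
    MemLp (fun p : Y × S => X p.1 p.2) 2 (μ.prod P) := by
  refine memLp_two_prod hXm hX.memLp ?_
  simpa only [← hX.cov_eq, covKernel, ← sq] using hK

variable [SFinite μ]

lemma covKernel_kernelOp [SFinite P] (hX : MemLp (fun p : Y × S => X p.1 p.2) 2 (μ.prod P))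
    (hX₂ : ∀ η, MemLp (X η) 2 P) (hΩ : ∀ ζ, MemLp (Ω ζ) 2 μ) (ζ₁ ζ₂ : Y) :
    covKernel P (fun ζ s => kernelOp μ Ω (X · s) ζ) ζ₁ ζ₂
      = kernelConj μ Ω (covKernel P X) ζ₁ ζ₂ := by
  simp only [covKernel, kernelOp, kernelConj]
  rw [integral_weighted_integral_mul hX (hΩ ζ₁) (memLp_weighted_integral hX (hΩ ζ₂))]
  refine integral_congr_ae (ae_of_all _ fun η₁ => ?_)
  calc Ω ζ₁ η₁ * ∫ s, X η₁ s * ∫ η₂, Ω ζ₂ η₂ * X η₂ s ∂μ ∂P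
      = Ω ζ₁ η₁ * ∫ s, (∫ η₂, Ω ζ₂ η₂ * X η₂ s ∂μ) * X η₁ s ∂P := by simp only [mul_comm]
    _ = Ω ζ₁ η₁ * ∫ η₂, Ω ζ₂ η₂ * ∫ s, X η₂ s * X η₁ s ∂P ∂μ := by
        rw [integral_weighted_integral_mul hX (hΩ ζ₂) (hX₂ η₁)]
    _ = ∫ η₂, Ω ζ₁ η₁ * (Ω ζ₂ η₂ * ∫ s, X η₂ s * X η₁ s ∂P) ∂μ := (integral_const_mul _ _).symm
    _ = ∫ η₂, Ω ζ₁ η₁ * (∫ s, X η₁ s * X η₂ s ∂P) * Ω ζ₂ η₂ ∂μ := by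
        simp only [mul_comm (X _ _) (X η₁ _), mul_comm (Ω ζ₂ _), mul_assoc]

lemma IsCenteredGP.kernelOp_add [IsProbabilityMeasure P] (hX : IsCenteredGP P X K)
    (hXm : Measurable fun p : Y × S => X p.1 p.2) (hK : Integrable (fun η => K η η) μ)
    (hΩ : ∀ ζ, MemLp (Ω ζ) 2 μ) (hw : IsCenteredGP P w W)
    (hind : IndepFun (fun s ζ => X ζ s) (fun s ζ => w ζ s) P) :
    IsCenteredGP P (fun ζ s => kernelOp μ Ω (X · s) ζ + w ζ s)
      (fun ζ₁ ζ₂ => kernelConj μ Ω K ζ₁ ζ₂ + W ζ₁ ζ₂) := by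
  have hX₂ : MemLp (fun p : Y × S => X p.1 p.2) 2 (μ.prod P) := hX.memLp_prod hXm hK
  have hJ : ∀ ζ, MemLp (fun s => kernelOp μ Ω (X · s) ζ) 2 P := fun ζ =>
    memLp_weighted_integral hX₂ (hΩ ζ)
  have hXw : ∀ t, MemLp (Sum.elim X w t) 2 P := by
    rintro (ζ | ζ)
    exacts [hX.memLp ζ, hw.memLp ζ]
  refine ⟨?_, fun ζ => ?_, fun ζ₁ ζ₂ => ?_⟩
  · refine isGaussianProcess_of_mem_closedSpan (isGaussianProcess_sumElim hX.gaussian hw.gaussian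
      hind) (hX₂ := hXw) (fun ζ => (hJ ζ).add (hw.memLp ζ)) fun ζ => ?_
    exact Submodule.add_mem _ (weighted_integral_mem_closedSpan hXw (i := Sum.inl) hX₂ (hΩ ζ))
      (toLp_mem_closedSpan hXw (Sum.inr ζ))
  · have hmean := integral_weighted_integral_mul hX₂ (hΩ ζ) (memLp_const (1 : ℝ))
    simp only [mul_one, hX.mean_zero, mul_zero, integral_zero] at hmean
    rw [integral_add ((hJ ζ).integrable (by norm_num)) ((hw.memLp ζ).integrable (by norm_num)),
      hw.mean_zero, add_zero]
    exact hmean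
  · have hJw : ∀ ζ₁ ζ₂, ∫ s, kernelOp μ Ω (X · s) ζ₁ * w ζ₂ s ∂P = 0 := fun ζ₁ ζ₂ =>
      (integral_weighted_integral_mul hX₂ (hΩ ζ₁) (hw.memLp ζ₂)).trans
        (by simp [hX.integral_mul_eq_zero_of_indepFun hw hind])
    rw [covKernel_add_of_orthogonal hJ hw.memLp hJw, covKernel_kernelOp hX₂ hX.memLp hΩ,
      hw.cov_eq, funext₂ hX.cov_eq]

end Transition

section LipschitzKernel

lemma kernelConj_eq_kernelOp {Y : Type*} [MeasurableSpace Y] {μ : Measure Y} (Ω K : Y → Y → ℝ)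
    (ζ₁ ζ₂ : Y) : kernelConj μ Ω K ζ₁ ζ₂ = kernelOp μ Ω (kernelOp μ K (Ω ζ₂)) ζ₁ := by
  simp only [kernelConj, kernelOp, mul_assoc, integral_const_mul]

variable {Y : Type*} [PseudoMetricSpace Y] {Ω K W : Y → Y → ℝ} {L LΩ LW : ℝ≥0}

lemma IsLipschitzKernel.flip (hK : IsLipschitzKernel L K) : IsLipschitzKernel L (flip K) :=
  ⟨hK.2, hK.1⟩

lemma IsLipschitzKernel.add (hK : IsLipschitzKernel L K) (hW : IsLipschitzKernel LW W) :
    IsLipschitzKernel (L + LW) (fun ζ₁ ζ₂ => K ζ₁ ζ₂ + W ζ₁ ζ₂) :=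
  ⟨fun y => (hK.1 y).add (hW.1 y), fun x => (hK.2 x).add (hW.2 x)⟩

lemma IsLipschitzKernel.continuous_uncurry (hK : IsLipschitzKernel L K) :
    Continuous (Function.uncurry K) :=
  (LipschitzWith.uncurry hK.1 hK.2).continuous

lemma IsLipschitzKernel.exists_bound [CompactSpace Y] (hK : IsLipschitzKernel L K) :
    ∃ B : ℝ≥0, ∀ x y, ‖K x y‖ ≤ B := by
  obtain ⟨B, hB⟩ := isCompact_univ.exists_bound_of_continuousOn hK.continuous_uncurry.continuousOn
  exact ⟨B.toNNReal, fun x y => (hB (x, y) (Set.mem_univ _)).trans (Real.le_coe_toNNReal B)⟩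

variable [MeasurableSpace Y] {μ : Measure Y} [IsFiniteMeasure μ]

lemma lipschitzWith_kernelOp (hΩ : ∀ η, LipschitzWith L (Ω · η)) {u : Y → ℝ}
    (hΩu : ∀ ζ, Integrable (fun η => Ω ζ η * u η) μ) {B : ℝ≥0} (hB : ∀ η, ‖u η‖ ≤ B) :
    LipschitzWith (L * B * measureUnivNNReal μ) (kernelOp μ Ω u) := by
  refine LipschitzWith.of_dist_le_mul fun x y => ?_
  have hdiff : ∀ η, ‖(Ω x η - Ω y η) * u η‖ ≤ L * dist x y * B := fun η => by
    rw [norm_mul]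
    exact mul_le_mul ((hΩ η).dist_le_mul x y) (hB η) (norm_nonneg _) (by positivity)
  calc dist (kernelOp μ Ω u x) (kernelOp μ Ω u y)
      = ‖∫ η, (Ω x η - Ω y η) * u η ∂μ‖ := by
        simp only [kernelOp, sub_mul, integral_sub (hΩu x) (hΩu y), dist_eq_norm]
    _ ≤ L * dist x y * B * μ.real Set.univ :=
        norm_integral_le_of_norm_le_const (ae_of_all _ hdiff)
    _ = (L * B * measureUnivNNReal μ : ℝ≥0) * dist x y := by
        rw [measureReal_def, ← coe_measureUnivNNReal, ENNReal.coe_toReal]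
        push_cast
        ring

variable [CompactSpace Y] [OpensMeasurableSpace Y]

lemma kernelConj_flip (hΩ : IsLipschitzKernel LΩ Ω) (hK : IsLipschitzKernel L K) (ζ₁ ζ₂ : Y) :
    kernelConj μ Ω (flip K) ζ₁ ζ₂ = kernelConj μ Ω K ζ₂ ζ₁ := by
  have hcont : Continuous fun p : Y × Y => Ω ζ₁ p.1 * K p.2 p.1 * Ω ζ₂ p.2 := by
    have := hK.continuous_uncurry
    have := hΩ.continuous_uncurry
    fun_prop
  have hint : Integrable (fun p : Y × Y => Ω ζ₁ p.1 * K p.2 p.1 * Ω ζ₂ p.2) (μ.prod μ) :=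
    hcont.integrable_of_hasCompactSupport (.of_compactSpace _)
  refine (integral_integral_swap hint).trans ?_
  simp only [kernelConj, mul_comm, mul_left_comm]
  rfl

lemma exists_lipschitzWith_kernelConj (hΩ : IsLipschitzKernel LΩ Ω) (hK : IsLipschitzKernel L K) :
    ∃ L' : ℝ≥0, ∀ ζ₂, LipschitzWith L' (fun ζ₁ => kernelConj μ Ω K ζ₁ ζ₂) := by
  obtain ⟨BΩ, hBΩ⟩ := hΩ.exists_bound
  obtain ⟨BK, hBK⟩ := hK.exists_bound
  have hint : ∀ {G : Y → Y → ℝ} {M : ℝ≥0} {u : Y → ℝ}, IsLipschitzKernel M G → Continuous u →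
      ∀ ζ, Integrable (fun η => G ζ η * u η) μ := fun hG hu ζ =>
    ((hG.2 ζ).continuous.mul hu).integrable_of_hasCompactSupport (.of_compactSpace _)
  refine ⟨LΩ * (BK * BΩ * measureUnivNNReal μ) * measureUnivNNReal μ, fun ζ₂ => ?_⟩
  simp only [kernelConj_eq_kernelOp]
  have hKΩ : Continuous (kernelOp μ K (Ω ζ₂)) :=
    (lipschitzWith_kernelOp hK.1 (hint hK (hΩ.2 ζ₂).continuous) (hBΩ ζ₂)).continuous
  refine lipschitzWith_kernelOp hΩ.1 (hint hΩ hKΩ) fun η => ?_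
  refine (norm_integral_le_of_norm_le_const (C := BK * BΩ) (ae_of_all _ fun η' => ?_)).trans_eq ?_
  · rw [norm_mul]
    exact mul_le_mul (hBK _ _) (hBΩ _ _) (norm_nonneg _) BK.coe_nonneg
  · rw [measureReal_def, ← coe_measureUnivNNReal, ENNReal.coe_toReal]
    push_cast
    rfl

lemma exists_isLipschitzKernel_kernelConj (hΩ : IsLipschitzKernel LΩ Ω)
    (hK : IsLipschitzKernel L K) : ∃ L' : ℝ≥0, IsLipschitzKernel L' (kernelConj μ Ω K) := by
  obtain ⟨L₁, h₁⟩ := exists_lipschitzWith_kernelConj (μ := μ) hΩ hK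
  obtain ⟨L₂, h₂⟩ := exists_lipschitzWith_kernelConj (μ := μ) hΩ hK.flip
  refine ⟨max L₁ L₂, fun ζ₂ => (h₁ ζ₂).weaken (le_max_left _ _), fun ζ₁ => ?_⟩
  simpa only [kernelConj_flip hΩ hK] using (h₂ ζ₁).weaken (le_max_right L₁ L₂)

end LipschitzKernel

section BoxDimension

/-- Finite upper box dimension: the covering numbers of `Y` at scale `2⁻ᵏ` grow at most
exponentially in `k`. It is the size condition on the index set in the chaining argument. -/
def HasFiniteBoxDim (Y : Type*) [PseudoMetricSpace Y] : Prop :=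
  ∃ A B : ℕ, ∀ k : ℕ, Metric.coveringNumber ((1 / 2) ^ k) (Set.univ : Set Y) ≤ (A * B ^ k : ℕ)

lemma HasFiniteBoxDim.exists_nets {Y : Type*} [PseudoMetricSpace Y] (hY : HasFiniteBoxDim Y) :
    ∃ (A B : ℕ) (N : ℕ → Finset Y) (π : ℕ → Y → Y), (∀ k, (N k).card ≤ A * B ^ k) ∧
      (∀ k x, π k x ∈ N k) ∧ ∀ k x, dist (π k x) x ≤ (1 / 2) ^ k := by
  obtain ⟨A, B, hAB⟩ := hY
  have hnet : ∀ k, ∃ N : Finset Y, N.card ≤ A * B ^ k ∧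
      ∀ x, ∃ y ∈ N, dist y x ≤ (1 / 2) ^ k := fun k => by
    obtain ⟨C, -, hCfin, hcover, hcard⟩ := Metric.exists_set_encard_eq_coveringNumber
      (ne_top_of_le_ne_top (ENat.natCast_ne_top _) (hAB k))
    refine ⟨hCfin.toFinset, ?_, fun x => ?_⟩
    · rw [← ENat.natCast_le_natCast, ← hCfin.encard_eq_coe_toFinset_card, hcard]
      exact hAB k
    · have hx := Metric.isCover_iff_subset_iUnion_closedBall.1 hcover (Set.mem_univ x)
      simpa [dist_comm x] using hx
  choose N hN π hπN hπ using hnet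
  exact ⟨A, B, N, π, hN, hπN, hπ⟩

variable {E : Type*} [NormedAddCommGroup E] [NormedSpace ℝ E] [ProperSpace E]

lemma exists_finset_isCover_half_closedBall :
    ∃ B : ℕ, ∀ (x : E) (r : ℝ≥0), ∃ C : Finset E, C.card ≤ B ∧
      Metric.IsCover (r / 2) (Metric.closedBall x r) (C : Set E) := by
  classical
  obtain ⟨C, -, hCfin, hC⟩ := Metric.exists_finite_isCover_of_isCompact (ε := 1 / 2) (by norm_num)
    (isCompact_closedBall (0 : E) 1)
  rw [Metric.isCover_iff_subset_iUnion_closedBall] at hC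
  refine ⟨hCfin.toFinset.card, fun x r => ⟨hCfin.toFinset.image fun c => x + (r : ℝ) • c,
    Finset.card_image_le, Metric.isCover_iff_subset_iUnion_closedBall.2 fun y hy => ?_⟩⟩
  rw [mem_closedBall_iff_norm] at hy
  obtain ⟨u, hu, rfl⟩ : ∃ u : E, ‖u‖ ≤ 1 ∧ y = x + (r : ℝ) • u := by
    rcases eq_or_ne r 0 with rfl | hr
    · exact ⟨0, by simp, by simpa [sub_eq_zero] using hy⟩
    · refine ⟨(r : ℝ)⁻¹ • (y - x), ?_, by simp [hr]⟩
      rw [norm_smul, norm_inv, Real.norm_of_nonneg r.coe_nonneg, inv_mul_eq_div]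
      exact div_le_one_of_le₀ hy r.coe_nonneg
  obtain ⟨c, hc, huc⟩ := Set.mem_iUnion₂.1 (hC (mem_closedBall_zero_iff.2 hu))
  refine Set.mem_iUnion₂.2 ⟨x + (r : ℝ) • c, by simpa using ⟨c, hc, rfl⟩, ?_⟩
  rw [Metric.mem_closedBall, dist_add_left, dist_smul₀, Real.norm_of_nonneg r.coe_nonneg]
  calc (r : ℝ) * dist u c ≤ r * (1 / 2 : ℝ≥0) := mul_le_mul_of_nonneg_left huc r.coe_nonneg
    _ = (r / 2 : ℝ≥0) := by push_cast; ring

lemma exists_externalCoveringNumber_closedBall_le :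
    ∃ B : ℕ, ∀ (k : ℕ) (x : E) (r : ℝ≥0), Metric.externalCoveringNumber (r * (1 / 2) ^ k)
      (Metric.closedBall x r) ≤ (B ^ k : ℕ) := by
  classical
  obtain ⟨B, hB⟩ := exists_finset_isCover_half_closedBall (E := E)
  choose C hCcard hC using hB
  have hcover : ∀ (k : ℕ) (x : E) (r : ℝ≥0), ∃ D : Finset E, D.card ≤ B ^ k ∧
      Metric.IsCover (r * (1 / 2) ^ k) (Metric.closedBall x r) (D : Set E) := by
    intro k x r
    induction k with
    | zero =>
      exact ⟨{x}, by simp, Metric.isCover_iff_subset_iUnion_closedBall.2 (by simp)⟩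
    | succ k ih =>
      obtain ⟨D, hDcard, hD⟩ := ih
      refine ⟨D.biUnion (C · (r * (1 / 2) ^ k)), ?_, ?_⟩
      · exact (Finset.card_biUnion_le_card_mul _ _ _ fun c _ => hCcard _ _).trans
          (Nat.mul_le_mul_right B hDcard)
      · rw [Metric.isCover_iff_subset_iUnion_closedBall] at hD ⊢
        intro y hy
        obtain ⟨c, hc, hyc⟩ := Set.mem_iUnion₂.1 (hD hy)
        obtain ⟨c', hc', hyc'⟩ := Set.mem_iUnion₂.1
          (Metric.isCover_iff_subset_iUnion_closedBall.1 (hC c (r * (1 / 2) ^ k)) hyc)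
        rw [pow_succ, ← mul_assoc, mul_one_div]
        exact Set.mem_iUnion₂.2 ⟨c', Finset.mem_biUnion.2 ⟨c, hc, hc'⟩, hyc'⟩
  refine ⟨B, fun k x r => ?_⟩
  obtain ⟨D, hDcard, hD⟩ := hcover k x r
  refine hD.externalCoveringNumber_le_encard.trans ?_
  rw [Set.encard_coe_eq_coe_finsetCard]
  exact_mod_cast hDcard

lemma hasFiniteBoxDim_of_isBounded {Y : Set E} (hY : Bornology.IsBounded Y) :
    HasFiniteBoxDim Y := by
  obtain ⟨B, hB⟩ := exists_externalCoveringNumber_closedBall_le (E := E)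
  obtain ⟨R, hR⟩ := hY.subset_closedBall 0
  obtain ⟨m, hm⟩ := pow_unbounded_of_one_lt R (one_lt_two (α := ℝ))
  refine ⟨B ^ (m + 1), B, fun k => ?_⟩
  have hball : Y ⊆ Metric.closedBall 0 (2 ^ m : ℝ≥0) :=
    hR.trans (Metric.closedBall_subset_closedBall (by exact_mod_cast hm.le))
  have hscale : (2 ^ m * (1 / 2) ^ (m + 1 + k) : ℝ≥0) = (1 / 2) ^ k / 2 := by
    rw [pow_add, pow_succ, ← mul_assoc, ← mul_assoc, ← mul_pow]
    norm_num
    ring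
  calc Metric.coveringNumber ((1 / 2) ^ k) (Set.univ : Set Y)
      = Metric.coveringNumber (2 * ((1 / 2) ^ k / 2)) Y := by
        rw [← isometry_subtype_coe.coveringNumber_image, Subtype.coe_image_univ,
          mul_div_cancel₀ _ two_ne_zero]
    _ ≤ Metric.externalCoveringNumber ((1 / 2) ^ k / 2) Y :=
        Metric.coveringNumber_two_mul_le_externalCoveringNumber _ _
    _ ≤ Metric.externalCoveringNumber ((1 / 2) ^ k / 2) (Metric.closedBall 0 (2 ^ m : ℝ≥0)) :=
        Metric.externalCoveringNumber_mono_set hball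
    _ ≤ (B ^ (m + 1) * B ^ k : ℕ) := by
        rw [← hscale, ← pow_add]
        exact hB (m + 1 + k) 0 (2 ^ m)

end BoxDimension

section Chaining

lemma ae_tendsto_of_tsum_measure_ne_top {S E : Type*} [MeasurableSpace S] [PseudoMetricSpace E]
    {P : Measure S} {Z : ℕ → S → E} {Z' : S → E} {ε : ℕ → ℝ} (hε : Tendsto ε atTop (𝓝 0))
    (h : ∑' k, P {s | ε k ≤ dist (Z k s) (Z' s)} ≠ ∞) :
    ∀ᵐ s ∂P, Tendsto (fun k => Z k s) atTop (𝓝 (Z' s)) := by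
  filter_upwards [ae_eventually_notMem h] with s hs
  refine tendsto_iff_dist_tendsto_zero.2 (squeeze_zero' (.of_forall fun _ => dist_nonneg) ?_ hε)
  filter_upwards [hs] with k hk using (not_le.1 hk).le

lemma ae_eventually_forall_mem_dist_lt {Y S : Type*} [MeasurableSpace S] {P : Measure S}
    {X : Y → S → ℝ} (Q : ℕ → Finset (Y × Y)) {ε : ℕ → ℝ} {δ : ℕ → ℝ≥0∞}
    (hQ : ∀ k, ∀ p ∈ Q k, P {s | ε k ≤ dist (X p.1 s) (X p.2 s)} ≤ δ k)
    (hδ : ∑' k, (Q k).card * δ k ≠ ∞) :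
    ∀ᵐ s ∂P, ∀ᶠ k in atTop, ∀ p ∈ Q k, dist (X p.1 s) (X p.2 s) < ε k := by
  have hunion : ∀ k, P (⋃ p ∈ Q k, {s | ε k ≤ dist (X p.1 s) (X p.2 s)}) ≤ (Q k).card * δ k :=
    fun k => by
      rw [← nsmul_eq_mul]
      exact (measure_biUnion_finset_le _ _).trans (Finset.sum_le_card_nsmul _ _ _ (hQ k))
  filter_upwards [ae_eventually_notMem (ne_top_of_le_ne_top hδ (ENNReal.tsum_le_tsum hunion))]
    with s hs
  filter_upwards [hs] with k hk p hp
  simp only [Set.mem_iUnion, not_exists] at hk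
  exact not_le.1 (hk p hp)

variable {Y : Type*} [PseudoMetricSpace Y]

open scoped Classical in
/-- The pairs of net points whose increments enter the `k`-th step of the chaining argument: they
belong to the nets of levels `k` and `k + 1` and are at distance `≲ 2⁻ᵏ`. -/
noncomputable def chainPairs (N : ℕ → Finset Y) (k : ℕ) : Finset (Y × Y) :=
  ((N k ∪ N (k + 1)) ×ˢ (N k ∪ N (k + 1))).filter fun p => dist p.1 p.2 ≤ 3 * (1 / 2) ^ k

lemma card_chainPairs_le (N : ℕ → Finset Y) (k : ℕ) :
    (chainPairs N k).card ≤ ((N k).card + (N (k + 1)).card) ^ 2 := by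
  classical
  calc (chainPairs N k).card ≤ (N k ∪ N (k + 1)).card ^ 2 :=
        (Finset.card_filter_le _ _).trans_eq (by rw [Finset.card_product, sq])
    _ ≤ ((N k).card + (N (k + 1)).card) ^ 2 := by gcongr; exact Finset.card_union_le _ _

lemma card_chainPairs_le_of_card_le {N : ℕ → Finset Y} {A B : ℕ}
    (hN : ∀ k, (N k).card ≤ A * B ^ k) (k : ℕ) :
    (chainPairs N k).card ≤ (A * (1 + B)) ^ 2 * (B ^ 2) ^ k :=
  calc (chainPairs N k).card ≤ ((N k).card + (N (k + 1)).card) ^ 2 := card_chainPairs_le N k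
    _ ≤ (A * B ^ k + A * B ^ (k + 1)) ^ 2 := by gcongr <;> exact hN _
    _ = (A * (1 + B)) ^ 2 * (B ^ 2) ^ k := by ring

variable {N : ℕ → Finset Y} {π : ℕ → Y → Y}

lemma mk_mem_chainPairs (hπN : ∀ k x, π k x ∈ N k) (hπ : ∀ k x, dist (π k x) x ≤ (1 / 2) ^ k)
    {k : ℕ} {x y : Y} (hxy : dist x y ≤ (1 / 2) ^ k) : (π k x, π k y) ∈ chainPairs N k := by
  classical
  refine Finset.mem_filter.2 ⟨Finset.mk_mem_product (Finset.mem_union_left _ (hπN k x))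
    (Finset.mem_union_left _ (hπN k y)), ?_⟩
  have := dist_triangle4 (π k x) x y (π k y)
  linarith [hπ k x, hπ k y, dist_comm y (π k y)]

lemma mk_succ_mem_chainPairs (hπN : ∀ k x, π k x ∈ N k)
    (hπ : ∀ k x, dist (π k x) x ≤ (1 / 2) ^ k) (k : ℕ) (x : Y) :
    (π k x, π (k + 1) x) ∈ chainPairs N k := by
  classical
  refine Finset.mem_filter.2 ⟨Finset.mk_mem_product (Finset.mem_union_left _ (hπN k x))
    (Finset.mem_union_right _ (hπN (k + 1) x)), ?_⟩
  have hpow : (1 / 2 : ℝ) ^ (k + 1) = (1 / 2) ^ k / 2 := by ring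
  have := dist_triangle_right (π k x) (π (k + 1) x) x
  linarith [hπ k x, hπ (k + 1) x, pow_pos (one_half_pos (α := ℝ)) k]

lemma exists_continuous_tendsto_of_chainPairs (hπN : ∀ k x, π k x ∈ N k)
    (hπ : ∀ k x, dist (π k x) x ≤ (1 / 2) ^ k) {ε : ℕ → ℝ} (hε : Summable ε) {g : Y → ℝ}
    (hg : ∀ᶠ k in atTop, ∀ p ∈ chainPairs N k, dist (g p.1) (g p.2) ≤ ε k) :
    ∃ g' : Y → ℝ, Continuous g' ∧ ∀ x, Tendsto (fun k => g (π k x)) atTop (𝓝 (g' x)) := by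
  obtain ⟨k₀, hk₀⟩ := eventually_atTop.1 hg
  have hstep : ∀ x k, k₀ ≤ k → ∀ j, dist (g (π (j + k) x)) (g (π (j + 1 + k) x)) ≤ ε (j + k) :=
    fun x k hk j => by
      rw [add_right_comm]
      exact hk₀ (j + k) (by lia) _ (mk_succ_mem_chainPairs hπN hπ (j + k) x)
  have hsum : ∀ k, Summable fun j => ε (j + k) := fun k => (summable_nat_add_iff k).2 hε
  have hlim : ∀ x, ∃ l, Tendsto (fun k => g (π k x)) atTop (𝓝 l) := fun x => by
    obtain ⟨l, hl⟩ := cauchySeq_tendsto_of_complete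
      (cauchySeq_of_dist_le_of_summable _ (hstep x k₀ le_rfl) (hsum k₀))
    exact ⟨l, (tendsto_add_atTop_iff_nat k₀).1 hl⟩
  choose g' hg' using hlim
  have htail : ∀ x k, k₀ ≤ k → dist (g (π k x)) (g' x) ≤ ∑' j, ε (j + k) := fun x k hk => by
    simpa using dist_le_tsum_of_dist_le_of_tendsto₀ _ (hstep x k hk) (hsum k)
      ((tendsto_add_atTop_iff_nat k).2 (hg' x))
  refine ⟨g', Metric.continuous_iff.2 fun x δ hδ => ?_, hg'⟩
  have hsmall : Tendsto (fun k => 2 * ∑' j, ε (j + k) + ε k) atTop (𝓝 0) := by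
    simpa using ((tendsto_sum_nat_add ε).const_mul 2).add hε.tendsto_atTop_zero
  obtain ⟨k, hkδ, hk⟩ := ((hsmall.eventually_lt_const hδ).and (eventually_ge_atTop k₀)).exists
  refine ⟨(1 / 2) ^ k, by positivity, fun y hy => ?_⟩
  calc dist (g' y) (g' x)
      ≤ dist (g' y) (g (π k y)) + dist (g (π k y)) (g (π k x)) + dist (g (π k x)) (g' x) :=
        dist_triangle4 _ _ _ _
    _ ≤ ∑' j, ε (j + k) + ε k + ∑' j, ε (j + k) := by
        rw [dist_comm (g' y)]
        gcongr
        exacts [htail y k hk, hk₀ k hk _ (mk_mem_chainPairs hπN hπ hy.le), htail x k hk]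
    _ < δ := by linarith

variable {S : Type*} [MeasurableSpace S] {P : Measure S} {X : Y → S → ℝ}

lemma hasContinuousVersion_of_chainPairs (hX : ∀ x, Measurable (X x)) (hπN : ∀ k x, π k x ∈ N k)
    (hπ : ∀ k x, dist (π k x) x ≤ (1 / 2) ^ k) {ε : ℕ → ℝ} (hε : Summable ε) {δ : ℕ → ℝ≥0∞}
    (htail : ∀ k x y, dist x y ≤ 3 * (1 / 2) ^ k → P {s | ε k ≤ dist (X x s) (X y s)} ≤ δ k)
    (hδ : ∑' k, (chainPairs N k).card * δ k ≠ ∞) : HasContinuousVersion P X := by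
  have hlocal : ∀ x, ∀ᵐ s ∂P, Tendsto (fun k => X (π k x) s) atTop (𝓝 (X x s)) := fun x => by
    refine ae_tendsto_of_tsum_measure_ne_top hε.tendsto_atTop_zero
      (ne_top_of_le_ne_top hδ (ENNReal.tsum_le_tsum fun k => ?_))
    have hcard : 1 ≤ (chainPairs N k).card :=
      Finset.card_pos.2 ⟨_, mk_succ_mem_chainPairs hπN hπ k x⟩
    have hdist : dist (π k x) x ≤ 3 * (1 / 2) ^ k :=
      (hπ k x).trans (by linarith [pow_pos (one_half_pos (α := ℝ)) k])
    exact (htail k _ _ hdist).trans (le_mul_of_one_le_left' (by exact_mod_cast hcard))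
  obtain ⟨G, hGae, hGm, hG⟩ := (ae_eventually_forall_mem_dist_lt (chainPairs N)
    (fun k p hp => htail k _ _ (Finset.mem_filter.1 hp).2) hδ).exists_measurable_mem
  have hlim : ∀ s, ∃ g : Y → ℝ, Continuous g ∧
      ∀ x, Tendsto (fun k => G.indicator (X (π k x)) s) atTop (𝓝 (g x)) := fun s => by
    by_cases hs : s ∈ G
    · simp only [Set.indicator_of_mem hs]
      refine exists_continuous_tendsto_of_chainPairs (g := (X · s)) hπN hπ hε ?_
      filter_upwards [hG s hs] with k hk p hp using (hk p hp).le
    · simp only [Set.indicator_of_notMem hs]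
      exact ⟨0, continuous_const, fun _ => tendsto_const_nhds⟩
  choose g hgc hg using hlim
  refine ⟨fun x s => g s x, fun x => ?_, hgc, fun x => ?_⟩
  · exact measurable_of_tendsto_metrizable (fun k => (hX (π k x)).indicator hGm)
      (tendsto_pi_nhds.2 fun s => hg s x)
  · filter_upwards [hGae, hlocal x] with s hs hsx
    refine tendsto_nhds_unique (hg s x) ?_
    simpa only [Set.indicator_of_mem hs] using hsx

end Chaining

section SeparableField

variable {Y S : Type*} [TopologicalSpace Y] [MeasurableSpace S] {P : Measure S} {X : Y → S → ℝ}

lemma HasContinuousVersion.ae_continuous_of_isSeparableField (h : HasContinuousVersion P X)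
    (hsep : IsSeparableField P X) : ∀ᵐ s ∂P, Continuous fun ζ => X ζ s := by
  obtain ⟨g, -, hgc, hgX⟩ := h
  obtain ⟨D, hD, hDX⟩ := hsep
  filter_upwards [hDX, (ae_ball_iff hD).2 fun ζ _ => hgX ζ] with s hs hgD
  have hgraph : IsClosed {p : Y × ℝ | g p.1 s = p.2} :=
    isClosed_eq ((hgc s).comp continuous_fst) continuous_snd
  have hsub : (fun η => (η, X η s)) '' D ⊆ {p : Y × ℝ | g p.1 s = p.2} := by
    rintro _ ⟨η, hη, rfl⟩
    exact hgD η hη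
  exact (hgc s).congr fun ζ => closure_minimal hsub hgraph (hs ζ)

end SeparableField

section GaussianTail

variable {S : Type*} [MeasurableSpace S] {P : Measure S}

lemma integral_pow_two_mul_of_hasGaussianLaw {Z : S → ℝ} (hZ : HasGaussianLaw Z P)
    (h0 : ∫ s, Z s ∂P = 0) (q : ℕ) : ∫ s, Z s ^ (2 * q) ∂P
      = (∫ s, Z s ^ 2 ∂P) ^ q * ∫ x, x ^ (2 * q) ∂gaussianReal 0 1 := by
  have hV : 0 ≤ ∫ s, Z s ^ 2 ∂P := integral_nonneg fun s => sq_nonneg _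
  have hmap : P.map Z = (gaussianReal 0 1).map (√(∫ s, Z s ^ 2 ∂P) * ·) := by
    rw [hZ.map_eq_gaussianReal, variance_of_integral_eq_zero hZ.aemeasurable h0, h0,
      gaussianReal_map_const_mul]
    congr 1
    · simp
    · ext; simp [Real.sq_sqrt hV, hV]
  rw [← integral_map (μ := P) hZ.aemeasurable (f := fun x : ℝ => x ^ (2 * q)) (by fun_prop),
    hmap, integral_map (by fun_prop) (by fun_prop), ← integral_const_mul]
  simp only [mul_pow, pow_mul, Real.sq_sqrt hV]

lemma integral_pow_two_mul_gaussianReal_nonneg (q : ℕ) :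
    0 ≤ ∫ x, x ^ (2 * q) ∂gaussianReal 0 1 :=
  integral_nonneg fun x => (even_two_mul q).pow_nonneg x

lemma measure_le_abs_le_of_hasGaussianLaw {Z : S → ℝ} (hZ : HasGaussianLaw Z P)
    (h0 : ∫ s, Z s ∂P = 0) {a : ℝ} (ha : 0 < a) (q : ℕ) :
    P {s | a ≤ |Z s|} ≤ ENNReal.ofReal
      ((∫ x, x ^ (2 * q) ∂gaussianReal 0 1) * ((∫ s, Z s ^ 2 ∂P) / a ^ 2) ^ q) := by
  have := hZ.isProbabilityMeasure
  have hint : Integrable (fun s => Z s ^ (2 * q)) P := by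
    simpa [pow_mul] using
      (hZ.memLp (p := (2 * q : ℕ)) (ENNReal.natCast_ne_top _)).integrable_norm_pow'
  have hmarkov := mul_meas_ge_le_integral_of_nonneg
    (ae_of_all P fun s => (even_two_mul q).pow_nonneg (Z s)) hint (a ^ (2 * q))
  rw [integral_pow_two_mul_of_hasGaussianLaw hZ h0] at hmarkov
  have hsub : {s | a ≤ |Z s|} ⊆ {s | a ^ (2 * q) ≤ Z s ^ (2 * q)} := fun s hs => by
    rw [Set.mem_ofPred_eq, ← (even_two_mul q).pow_abs (Z s)]
    exact pow_le_pow_left₀ ha.le hs (2 * q)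
  rw [← ofReal_measureReal]
  refine ENNReal.ofReal_le_ofReal ((measureReal_mono hsub).trans ?_)
  rw [div_pow, ← pow_mul, mul_div_assoc', le_div_iff₀ (by positivity)]
  linarith

end GaussianTail

section LipschitzCovariance

variable {Y S : Type*} [PseudoMetricSpace Y] [MeasurableSpace S] {P : Measure S}
  {X : Y → S → ℝ} {K : Y → Y → ℝ} {L : ℝ≥0}

lemma IsCenteredGP.integral_sub_sq_le (hX : IsCenteredGP P X K) (hK : IsLipschitzKernel L K)
    (x y : Y) : ∫ s, (X x s - X y s) ^ 2 ∂P ≤ 2 * L * dist x y := by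
  have hint : ∀ a b, Integrable (fun s => X a s * X b s) P := fun a b =>
    MemLp.integrable_mul (hX.memLp a) (hX.memLp b)
  calc ∫ s, (X x s - X y s) ^ 2 ∂P
      = ∫ s, (X x s * X x s - X y s * X x s) - (X x s * X y s - X y s * X y s) ∂P :=
        integral_congr_ae (ae_of_all _ fun s => by ring)
    _ = (K x x - K y x) - (K x y - K y y) := by
        rw [integral_sub (by exact (hint x x).sub (hint y x)) (by exact (hint x y).sub (hint y y)),
          integral_sub (hint x x) (hint y x), integral_sub (hint x y) (hint y y)]
        simp only [← hX.cov_eq, covKernel]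
    _ ≤ |K x x - K y x| + |K x y - K y y| :=
        (le_abs_self _).trans (abs_sub _ _)
    _ ≤ L * dist x y + L * dist x y := add_le_add ((hK.1 x).dist_le_mul x y)
        ((hK.1 y).dist_le_mul x y)
    _ = 2 * L * dist x y := by ring

lemma IsCenteredGP.measure_le_dist_le (hX : IsCenteredGP P X K) (hK : IsLipschitzKernel L K)
    (x y : Y) {a : ℝ} (ha : 0 < a) (q : ℕ) :
    P {s | a ≤ dist (X x s) (X y s)} ≤ ENNReal.ofReal
      ((∫ z, z ^ (2 * q) ∂gaussianReal 0 1) * (2 * L * dist x y / a ^ 2) ^ q) := by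
  have hgauss : HasGaussianLaw (fun s => X x s - X y s) P := hX.gaussian.hasGaussianLaw_fun_sub
  have hmean : ∫ s, (X x s - X y s) ∂P = 0 := by
    have := hgauss.isProbabilityMeasure
    rw [integral_sub ((hX.memLp x).integrable (by norm_num))
      ((hX.memLp y).integrable (by norm_num)), hX.mean_zero, hX.mean_zero, sub_zero]
  have hmoment := integral_pow_two_mul_gaussianReal_nonneg q
  refine (measure_le_abs_le_of_hasGaussianLaw hgauss hmean ha q).trans
    (ENNReal.ofReal_le_ofReal ?_)
  gcongr
  exact hX.integral_sub_sq_le hK x y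

lemma IsCenteredGP.measure_three_fourths_pow_le_dist_le (hX : IsCenteredGP P X K)
    (hK : IsLipschitzKernel L K) {x y : Y} {k : ℕ} (hxy : dist x y ≤ 3 * (1 / 2) ^ k) (q : ℕ) :
    P {s | (3 / 4) ^ k ≤ dist (X x s) (X y s)} ≤ ENNReal.ofReal
      ((∫ z, z ^ (2 * q) ∂gaussianReal 0 1) * (6 * L * (8 / 9) ^ k) ^ q) := by
  have hratio : 2 * L * (3 * (1 / 2) ^ k) / ((3 / 4) ^ k) ^ 2 = 6 * L * (8 / 9 : ℝ) ^ k := by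
    rw [show (8 / 9 : ℝ) = 1 / 2 / (3 / 4) ^ 2 by norm_num, div_pow (1 / 2 : ℝ),
      ← pow_mul _ 2, ← pow_mul _ k, mul_comm k 2]
    ring
  have hmoment := integral_pow_two_mul_gaussianReal_nonneg q
  refine (hX.measure_le_dist_le hK x y (by positivity) q).trans (ENNReal.ofReal_le_ofReal ?_)
  rw [← hratio]
  gcongr

-- Increments at distance `≲ 2⁻ᵏ` have variance `≲ 2⁻ᵏ`; against the threshold `(3/4)ᵏ` the moment
-- of order `2q` gains `(8/9)^(qk)`, which beats the `≲ B^(2k)` pairs of level `k` for large `q`.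
lemma IsCenteredGP.hasContinuousVersion (hX : IsCenteredGP P X K) (hm : ∀ ζ, Measurable (X ζ))
    (hK : IsLipschitzKernel L K) (hY : HasFiniteBoxDim Y) : HasContinuousVersion P X := by
  obtain ⟨A, B, N, π, hN, hπN, hπ⟩ := hY.exists_nets
  obtain ⟨q, hq⟩ := exists_pow_lt_of_lt_one (by positivity : (0 : ℝ) < 1 / (B ^ 2 + 1))
    (by norm_num : (8 / 9 : ℝ) < 1)
  have hr : (B ^ 2 : ℝ) * (8 / 9) ^ q < 1 := by
    rw [lt_div_iff₀ (by positivity)] at hq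
    linarith [pow_pos (by norm_num : (0 : ℝ) < 8 / 9) q]
  set M : ℝ := ∫ z, z ^ (2 * q) ∂gaussianReal 0 1
  have hM : 0 ≤ M := integral_pow_two_mul_gaussianReal_nonneg q
  have hlevel : ∀ k, (chainPairs N k).card * ENNReal.ofReal (M * (6 * L * (8 / 9) ^ k) ^ q) ≤
      ENNReal.ofReal ((A * (1 + B)) ^ 2 * (M * (6 * L) ^ q) * (B ^ 2 * (8 / 9) ^ q) ^ k) := by
    intro k
    rw [← ENNReal.ofReal_natCast, ← ENNReal.ofReal_mul (by positivity)]
    refine ENNReal.ofReal_le_ofReal ?_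
    calc (chainPairs N k).card * (M * (6 * L * (8 / 9 : ℝ) ^ k) ^ q)
        ≤ (A * (1 + B)) ^ 2 * (B ^ 2) ^ k * (M * (6 * L * (8 / 9 : ℝ) ^ k) ^ q) := by
          gcongr
          exact_mod_cast card_chainPairs_le_of_card_le hN k
      _ = (A * (1 + B)) ^ 2 * (M * (6 * L) ^ q) * (B ^ 2 * (8 / 9) ^ q) ^ k := by ring
  have hsum : Summable fun k => (A * (1 + B)) ^ 2 * (M * (6 * L) ^ q) * (B ^ 2 * (8 / 9) ^ q) ^ k :=
    (summable_geometric_of_lt_one (by positivity) hr).mul_left _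
  exact hasContinuousVersion_of_chainPairs hm hπN hπ
    (summable_geometric_of_lt_one (by norm_num) (by norm_num))
    (fun k x y hxy => hX.measure_three_fourths_pow_le_dist_le hK hxy q)
    (ne_top_of_le_ne_top hsum.tsum_ofReal_ne_top (ENNReal.tsum_le_tsum hlevel))

end LipschitzCovariance

section System

variable {Y S : Type*} [PseudoMetricSpace Y] [CompactSpace Y] [MeasurableSpace Y]
  [OpensMeasurableSpace Y] [MeasurableSpace S] {μ : Measure Y} [IsFiniteMeasure μ]
  {P : Measure S} [IsProbabilityMeasure P] {n t : ℕ} {Ω W : Y → Y → ℝ} {f ω : ℕ → Y → S → ℝ}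
  {L LΩ LW : ℝ≥0}

lemma IsLGDS.isCenteredGP_succ (hsys : IsLGDS μ P n Ω W f ω) (hΩ : IsLipschitzKernel LΩ Ω)
    (ht : t < n) (hf : IsCenteredGP P (f t) (covKernel P (f t)))
    (hΨ : IsLipschitzKernel L (covKernel P (f t))) :
    IsCenteredGP P (f (t + 1))
      (fun ζ₁ ζ₂ => kernelConj μ Ω (covKernel P (f t)) ζ₁ ζ₂ + W ζ₁ ζ₂) := by
  have hdiag : Integrable (fun η => covKernel P (f t) η η) μ :=
    (hΨ.continuous_uncurry.comp (continuous_id.prodMk continuous_id)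
      ).integrable_of_hasCompactSupport (.of_compactSpace _)
  have hΩ₂ : ∀ ζ, MemLp (Ω ζ) 2 μ := fun ζ =>
    (hΩ.2 ζ).continuous.memLp_of_hasCompactSupport (.of_compactSpace _)
  exact (hf.kernelOp_add (hsys.measurable t ht.le) hdiag hΩ₂ (hsys.noise t ht)
    (hsys.indep t ht)).congr fun ζ => (hsys.dynamics t ht ζ).mono fun _ h => h.symm

lemma IsLGDS.isCenteredGP_and_isLipschitzKernel (hsys : IsLGDS μ P n Ω W f ω)
    (hΩ : IsLipschitzKernel LΩ Ω) (hW : IsLipschitzKernel LW W)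
    (hΨ₀ : ∃ L₀ : ℝ≥0, IsLipschitzKernel L₀ (covKernel P (f 0))) (ht : t ≤ n) :
    IsCenteredGP P (f t) (covKernel P (f t)) ∧
      ∃ L : ℝ≥0, IsLipschitzKernel L (covKernel P (f t)) := by
  induction t with
  | zero => exact ⟨hsys.initial, hΨ₀⟩
  | succ t ih =>
    obtain ⟨hf, L, hΨ⟩ := ih (Nat.le_of_succ_le ht)
    have hf' := hsys.isCenteredGP_succ hΩ ht hf hΨ
    obtain ⟨L', hL'⟩ := exists_isLipschitzKernel_kernelConj (μ := μ) hΩ hΨ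
    refine ⟨⟨hf'.gaussian, hf'.mean_zero, fun _ _ => rfl⟩, L' + LW, ?_⟩
    rw [funext₂ hf'.cov_eq]
    exact hL'.add hW

end System

lemma isFiniteMeasure_lebesgueOn {h : ℕ} {Y : Set (EuclideanSpace ℝ (Fin h))} (hY : IsCompact Y) :
    IsFiniteMeasure (lebesgueOn Y) where
  measure_univ_lt_top := by
    rw [lebesgueOn, comap_subtype_coe_apply hY.measurableSet, Set.image_univ, Subtype.range_coe]
    exact hY.measure_lt_top

end LGDS

open LGDS in
theorem theorem2_general {Y : Type*} [PseudoMetricSpace Y] [CompactSpace Y] [MeasurableSpace Y]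
    [OpensMeasurableSpace Y] (hY : HasFiniteBoxDim Y) (μ : Measure Y) [IsFiniteMeasure μ]
    {S : Type*} [MeasurableSpace S] (P : Measure S) [IsProbabilityMeasure P]
    (n : ℕ) (Ω W : Y → Y → ℝ) (f ω : ℕ → Y → S → ℝ) (hsys : IsLGDS μ P n Ω W f ω)
    (LΩ LW : ℝ≥0) (hΩ : IsLipschitzKernel LΩ Ω) (hW : IsLipschitzKernel LW W)
    (hΨ0 : ∃ L₀ : ℝ≥0, IsLipschitzKernel L₀ (covKernel P (f 0))) :
    (∀ t ≤ n, ∀ ζ, MemLp (f t ζ) 2 P ∧ ∫ s, f t ζ s ∂P = 0) ∧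
    (∀ t < n, ∀ ζ₁ ζ₂, covKernel P (f (t + 1)) ζ₁ ζ₂
      = kernelConj μ Ω (covKernel P (f t)) ζ₁ ζ₂ + W ζ₁ ζ₂) ∧
    (∀ t ≤ n, ∃ L : ℝ≥0, IsLipschitzKernel L (covKernel P (f t))) ∧
    (∀ t ≤ n, HasContinuousVersion P (f t) ∧
      (IsSeparableField P (f t) → ∀ᵐ s ∂P, Continuous (fun ζ => f t ζ s))) := by
  have hstate := fun t => hsys.isCenteredGP_and_isLipschitzKernel (t := t) hΩ hW hΨ0
  refine ⟨fun t ht ζ => ⟨(hstate t ht).1.memLp ζ, (hstate t ht).1.mean_zero ζ⟩,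
    fun t ht => ?_, fun t ht => (hstate t ht).2, fun t ht => ?_⟩
  · obtain ⟨hf, L, hΨ⟩ := hstate t ht.le
    exact (hsys.isCenteredGP_succ hΩ ht hf hΨ).cov_eq
  · obtain ⟨hf, L, hΨ⟩ := hstate t ht
    have hversion : HasContinuousVersion P (f t) :=
      hf.hasContinuousVersion (fun _ => (hsys.measurable t ht).of_uncurry_left) hΨ hY
    exact ⟨hversion, hversion.ae_continuous_of_isSeparableField⟩

open LGDS in
theorem theorem2 {h : ℕ} (Y : Set (EuclideanSpace ℝ (Fin h))) (hY : IsCompact Y)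
    {S : Type*} [MeasurableSpace S] (P : Measure S) [IsProbabilityMeasure P]
    (n : ℕ) (Ω W : Y → Y → ℝ) (f ω : ℕ → Y → S → ℝ)
    (hsys : IsLGDS (lebesgueOn Y) P n Ω W f ω)
    (LΩ LW : ℝ≥0) (hΩ : IsLipschitzKernel LΩ Ω) (hW : IsLipschitzKernel LW W)
    (C : ℝ) (hC : C ∈ Set.Ioo (0 : ℝ) 1) (hcontr : IsContractingKernel (lebesgueOn Y) C Ω)
    (hWpsd : IsPosSemidefKernel W)
    (hΨpd : ∀ t ∈ Finset.Icc 1 n, IsPosDefKernel (covKernel P (f t)))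
    (hΨ0 : ∃ L₀ : ℝ≥0, IsLipschitzKernel L₀ (covKernel P (f 0))) :
    -- `Ψ_t` is the covariance of a centred square-integrable field
    (∀ t ≤ n, ∀ ζ, MemLp (f t ζ) 2 P ∧ ∫ s, f t ζ s ∂P = 0) ∧
    -- `Ψ_{t+1} = Ω Ψ_t Ω' + W`
    (∀ t < n, ∀ ζ₁ ζ₂, covKernel P (f (t + 1)) ζ₁ ζ₂
      = kernelConj (lebesgueOn Y) Ω (covKernel P (f t)) ζ₁ ζ₂ + W ζ₁ ζ₂) ∧
    -- `Ψ_t` is Lipschitz in both arguments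
    (∀ t ≤ n, ∃ L : ℝ≥0, IsLipschitzKernel L (covKernel P (f t))) ∧
    -- `f_t` is almost surely continuous
    (∀ t ≤ n, HasContinuousVersion P (f t) ∧
      (IsSeparableField P (f t) → ∀ᵐ s ∂P, Continuous (fun ζ => f t ζ s))) := by
  have : CompactSpace Y := isCompact_iff_compactSpace.1 hY
  have := isFiniteMeasure_lebesgueOn hY
  exact theorem2_general (hasFiniteBoxDim_of_isBounded hY.isBounded) _ P n Ω W f ω hsys
    LΩ LW hΩ hW hΨ0
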